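/- Let $T\in\{0,1\}^{k\times k}$, let $\Sigma^+=\{x\in\{1,\dots,k\}^{\mathbb N}: T_{x_ix_{i+1}}=1\ \forall i\ge 0\}$ be the corresponding one-sided subshift of finite type with shift $\sigma$, and assume that $\Sigma^+$ is non-empty and that $\sigma$ is topologically mixing. Let $\lambda>1$, let $d(x,y)=\lambda^{-n}$ with $n=\min\{i: x_i\ne y_i\}$ for $x\neq y$ (and $d(x,x)=0$), let $0<\alpha\le 1$, and put $\mathrm{Hold}_\alpha(f)=\sup_{0<d(x,y)\le 1}|f(x)-f(y)|/d(x,y)^\alpha$. Let $A:\Sigma^+\to\mathbb R$ be $\alpha$-Hölder, i.e. $\mathrm{Hold}_\alpha(A)<\infty$. Let $m=\sup_\nu\int A\,d\nu$ over the $\sigma$-invariant Borel probability measures $\nu$, and call an invariant probability $\mu$ maximizing if $\int A\,d\mu=m$. For $x,y\in\Sigma^+$ and $\delta>0$ define $$S_\delta(x,y)=\sup\Big\{\sum_{i=0}^{n-1}\big[A(\sigma^iz)-m\big] : n>0,\ \sigma^nz=y,\ d(z,x)<\delta\Big\},\qquad S(x,y)=\lim_{\delta\to0^+}S_\delta(x,y)\in[-\infty,\infty],$$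 and let $\mathfrak S=\{x\in\Sigma^+: S(x,x)=0\}$. Then: 1. There is $Q>0$ such that $S_\delta(x,y)<Q$ for all $x,y\in\Sigma^+$ and $\delta>0$. 2. $S(x,x)\le 0$ for all $x$. 3. $S(x,y)+S(y,z)\le S(x,z)$ for all $x,y,z$. 4. $\mathfrak S$ is closed, non-empty and forward invariant ($\sigma(\mathfrak S)\subseteq\mathfrak S$). An invariant probability measure $\mu$ is maximizing if and only if $\operatorname{supp}\mu\subseteq\mathfrak S$. 5. If $x\in\mathfrak S$, then $W(y)=S(x,y)$ is finite for every $y$ and $\alpha$-Hölder continuous, with $\mathrm{Hold}_\alpha(W)\le C\,\mathrm{Hold}_\alpha(A)$, where $C$ depends only on $\lambda$, $\alpha$ and $\Sigma^+$; and $|W(y)-W(z)|\le C_0\,\mathrm{Hold}_\alpha(A)\,d(y,z)^\alpha$ whenever $d(y,z)\le\lambda^{-1}$, where $C_0$ depends only on $\lambda$ and $\alpha$. Moreover $W(z)-W(y)\ge S(y,z)$ for all $y,z$. 6. With $x$ and $W$ as in 5, the function $B=A-m+W-W\circ\sigma$ is $\alpha$-Hölder continuous, $B\le 0$, $\int B\,d\nu=\int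 A\,d\nu-m$ for every invariant probability $\nu$, $\int B\,d\mu=0$ for every maximizing $\mu$, and $B=0$ on $\mathfrak S$; in particular $B=0$, i.e. $A=W\circ\sigma-W+m$, on $\operatorname{supp}\mu$ for every maximizing $\mu$. 7. If $\mu$ is maximizing, then every invariant probability $\nu$ with $\operatorname{supp}\nu\subseteq\operatorname{supp}\mu$ is maximizing. If $A$ has a unique maximizing measure $\mu$, then $\mathfrak S$ and $\operatorname{supp}\mu$ are uniquely ergodic, i.e. each carries exactly one invariant probability measure. -/

import Mathlib

open MeasureTheory Filter Topology
open scoped ENNReal NNReal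

noncomputable section

namespace SFTMax

/-- The one-sided subshift of finite type of a transition relation `T` (that is, of a `0`-`1`
matrix) on the finite alphabet `Fin k`. It carries the product topology and its Borel sets. -/
abbrev Subshift {k : ℕ} (T : Fin k → Fin k → Prop) : Type :=
  {x : ℕ → Fin k // ∀ i, T (x i) (x (i + 1))}

variable {k : ℕ} {T : Fin k → Fin k → Prop}

/-- The shift map `σ`. -/
def shift (x : Subshift T) : Subshift T :=
  ⟨fun i => x.1 (i + 1), fun i => x.2 (i + 1)⟩

/-- Topological mixing of the shift. -/
def IsTopMixing (T : Fin k → Fin k → Prop) : Prop :=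
  ∀ U V : Set (Subshift T), IsOpen U → IsOpen V → U.Nonempty → V.Nonempty →
    ∃ N : ℕ, ∀ n ≥ N, (U ∩ shift^[n] ⁻¹' V).Nonempty

/-- The metric `d(x, y) = lam ^ (-n)`, `n = min {i | x i ≠ y i}`, with expansion rate `lam > 1`. -/
def symDist (lam : ℝ) (x y : Subshift T) : ℝ :=
  open Classical in if x = y then 0 else (lam ^ PiNat.firstDiff x.1 y.1)⁻¹

/-- `sup |f x - f y| / d(x, y) ^ α` over the pairs with `0 < d(x, y) ≤ r`, in `[0, ∞]`. -/
def holdUpTo (lam α r : ℝ) (f : Subshift T → ℝ) : ℝ≥0∞ :=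
  ⨆ (x : Subshift T) (y : Subshift T) (_ : 0 < symDist lam x y ∧ symDist lam x y ≤ r),
    ENNReal.ofReal (|f x - f y| / symDist lam x y ^ α)

/-- The Hölder constant of exponent `α`: the supremum over `0 < d(x, y) ≤ 1`. -/
def hold (lam α : ℝ) (f : Subshift T → ℝ) : ℝ≥0∞ := holdUpTo lam α 1 f

/-- `f` is `α`-Hölder continuous. -/
def IsHolder (lam α : ℝ) (f : Subshift T → ℝ) : Prop := hold lam α f < ∞

/-- `ν` is a shift-invariant Borel probability measure. -/
def IsInvProb (ν : Measure (Subshift T)) : Prop :=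
  IsProbabilityMeasure ν ∧ MeasurePreserving shift ν ν

/-- `m(A)`: the supremum of `∫ A dν` over the invariant Borel probabilities `ν`. -/
def maxMean (A : Subshift T → ℝ) : ℝ :=
  sSup {r : ℝ | ∃ ν : Measure (Subshift T), IsInvProb ν ∧ ∫ x, A x ∂ν = r}

/-- `μ` is a maximizing measure for `A`. -/
def IsMaximizing (A : Subshift T → ℝ) (μ : Measure (Subshift T)) : Prop :=
  IsInvProb μ ∧ ∫ x, A x ∂μ = maxMean A

/-- `S_δ(x, y)`: the supremum of `∑_{i < n} (A (σ^i z) - m(A))` over `n > 0` and over `z` with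
`σ^n z = y` and `d(z, x) < δ`. -/
def actionAt (lam : ℝ) (A : Subshift T → ℝ) (δ : ℝ) (x y : Subshift T) : EReal :=
  ⨆ (n : ℕ) (z : Subshift T) (_ : 0 < n ∧ shift^[n] z = y ∧ symDist lam z x < δ),
    ((∑ i ∈ Finset.range n, (A (shift^[i] z) - maxMean A) : ℝ) : EReal)

/-- The action potential `S(x, y)`, the limit of `S_δ(x, y)` as `δ → 0+`, written as the infimum
over `δ > 0` (see `tendsto_actionAt`). -/
def action (lam : ℝ) (A : Subshift T → ℝ) (x y : Subshift T) : EReal :=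
  ⨅ (δ : ℝ) (_ : 0 < δ), actionAt lam A δ x y

/-- The set `𝔖` of the points `x` with `S(x, x) = 0`. -/
def zeroSet (lam : ℝ) (A : Subshift T → ℝ) : Set (Subshift T) :=
  {x | action lam A x x = 0}

/-- Exactly one shift-invariant Borel probability is carried by `K`. -/
def UniquelyErgodicOn (K : Set (Subshift T)) : Prop :=
  ∃! ν : Measure (Subshift T), IsInvProb ν ∧ ν Kᶜ = 0

theorem actionAt_mono (lam : ℝ) (A : Subshift T → ℝ) (x y : Subshift T) :
    Monotone fun δ => actionAt lam A δ x y := by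
  intro δ δ' h
  refine iSup_mono fun n => iSup_mono fun z => ?_
  exact iSup_mono' fun hz => ⟨⟨hz.1, hz.2.1, hz.2.2.trans_le h⟩, le_rfl⟩

theorem tendsto_actionAt (lam : ℝ) (A : Subshift T → ℝ) (x y : Subshift T) :
    Tendsto (fun δ => actionAt lam A δ x y) (𝓝[>] 0) (𝓝 (action lam A x y)) := by
  have h := (actionAt_mono lam A x y).tendsto_nhdsGT 0
  rwa [sInf_image] at h

/-- The metric induces the topology of the subshift. -/
theorem nhds_basis_symDist {lam : ℝ} (hlam : 1 < lam) (x : Subshift T) :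
    (𝓝 x).HasBasis (fun r : ℝ => 0 < r) (fun r => {y | symDist lam y x < r}) := by
  have hpos : ∀ n : ℕ, 0 < (lam ^ n)⁻¹ := fun n => inv_pos.2 (pow_pos (by linarith) n)
  have hcyl : ∀ (n : ℕ) (y : Subshift T), symDist lam y x < (lam ^ n)⁻¹ →
      y.1 ∈ PiNat.cylinder x.1 n := by
    intro n y hy
    by_cases h : y = x
    · exact h ▸ PiNat.self_mem_cylinder _ _
    · rw [symDist, if_neg h, inv_lt_inv₀ (pow_pos (by linarith) _) (pow_pos (by linarith) _),
        pow_lt_pow_iff_right₀ hlam] at hy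
      exact (PiNat.mem_cylinder_iff_le_firstDiff (fun e => h (Subtype.ext e)) n).2 hy.le
  refine ⟨fun s => ⟨fun hs => ?_, ?_⟩⟩
  · obtain ⟨u, hu, hus⟩ := mem_nhds_subtype _ x s |>.1 hs
    obtain ⟨v, hv, hxv, hvu⟩ :=
      (PiNat.isTopologicalBasis_cylinders fun _ : ℕ => Fin k).mem_nhds_iff.1 hu
    obtain ⟨w, n, rfl⟩ := hv
    refine ⟨(lam ^ n)⁻¹, hpos n, fun y hy => hus (hvu ?_)⟩
    rw [← PiNat.mem_cylinder_iff_eq.1 hxv]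
    exact hcyl n y hy
  · rintro ⟨r, hr, hs⟩
    obtain ⟨n, hn⟩ := exists_pow_lt_of_lt_one hr (inv_lt_one_of_one_lt₀ hlam)
    have ho : IsOpen {y : Subshift T | y.1 ∈ PiNat.cylinder x.1 n} :=
      (PiNat.isOpen_cylinder _ x.1 n).preimage continuous_subtype_val
    refine mem_of_superset (ho.mem_nhds (PiNat.self_mem_cylinder _ _)) fun y hy => hs ?_
    by_cases h : y = x
    · simpa [symDist, h] using hr
    · have := (PiNat.mem_cylinder_iff_le_firstDiff (fun e => h (Subtype.ext e)) n).1 hy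
      simp only [Set.mem_ofPred_eq, symDist, if_neg h]
      refine lt_of_le_of_lt ?_ (inv_pow lam n ▸ hn)
      exact inv_anti₀ (pow_pos (by linarith) _) (pow_le_pow_right₀ hlam.le this)

end SFTMax

end

open SFTMax

/-!
Since the shift expands at the rate `lam`, the sums of a Hölder function along `n` steps of two
orbits which agree up to time `n + N` differ by at most a constant times `r ^ N`, `r = lam ^ (-α)`.
Orbit segments can therefore be concatenated, or closed up to periodic orbits, at a cost that tends
to `0` with the scale; as `A - m` has nonpositive sums over periodic orbits, all of its Birkhoff
sums are bounded above, and the action is superadditive with `S(x, x) ≤ 0`.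

The supremum of the sums of `A - m` over all pasts of a point is then a continuous function whose
coboundary turns `A - m` into a nonpositive function, hence one vanishing almost everywhere for a
maximizing measure. Poincaré recurrence now yields returns with almost zero sums near each point
of the support, which is why the support lies in `𝔖`. Conversely, at a point `x` of `𝔖` one may
loop as long as desired before leaving, so that `W = S(x, ·)` is finite and its values at two nearby
points are compared by changing only the end of a long segment. On `𝔖` the bounds
`S(y, σ y) ≥ A y - m` and `S(σ y, y) ≥ m - A y` force `A - m + W - W ∘ σ` to vanish.
-/

namespace SFTMax

section Coboundary

variable {X : Type*} {f : X → X} {φ u : X → ℝ}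

/-- The function `φ + u - u ∘ f`, that is, `φ` modified by the coboundary of `u`. -/
def addCoboundary (f : X → X) (φ u : X → ℝ) (x : X) : ℝ := φ x + u x - u (f x)

theorem birkhoffSum_addCoboundary (n : ℕ) (x : X) :
    birkhoffSum f (addCoboundary f φ u) n x = birkhoffSum f φ n x + u x - u (f^[n] x) := by
  induction n with
  | zero => simp
  | succ n ih =>
    rw [birkhoffSum_succ, birkhoffSum_succ, ih, addCoboundary, Function.iterate_succ_apply']
    ring

theorem abs_birkhoffSum_le {K : ℝ} (hK : ∀ x, |φ x| ≤ K) (n : ℕ) (x : X) :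
    |birkhoffSum f φ n x| ≤ n * K := by
  calc |birkhoffSum f φ n x| ≤ ∑ i ∈ Finset.range n, |φ (f^[i] x)| := Finset.abs_sum_le_sum_abs _ _
    _ ≤ n * K := by
      simpa using Finset.sum_le_card_nsmul (Finset.range n) _ K fun i _ => hK (f^[i] x)

theorem integral_addCoboundary [MeasurableSpace X] {μ : Measure X} (hf : MeasurePreserving f μ μ)
    (hφ : Integrable φ μ) (hu : Integrable u μ) :
    ∫ x, addCoboundary f φ u x ∂μ = ∫ x, φ x ∂μ := by
  have hu' : ∫ x, u (f x) ∂μ = ∫ x, u x ∂μ := by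
    rw [← integral_map hf.aemeasurable (hf.map_eq.symm ▸ hu.aestronglyMeasurable), hf.map_eq]
  calc ∫ x, addCoboundary f φ u x ∂μ = ∫ x, (φ x + u x) ∂μ - ∫ x, u (f x) ∂μ :=
        integral_sub (hφ.add hu) (hf.integrable_comp_of_integrable hu)
    _ = ∫ x, φ x ∂μ := by rw [integral_add hφ hu, hu', add_sub_cancel_right]

end Coboundary

section InvariantMeasures

variable {X : Type*} [MeasurableSpace X] {f : X → X}

theorem exists_return_birkhoffSum_eq_zero {μ : Measure X} [IsFiniteMeasure μ] {φ : X → ℝ}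
    {s : Set X} (hf : MeasurePreserving f μ μ) (hφ : φ =ᵐ[μ] 0) (hs : NullMeasurableSet s μ)
    (hμs : μ s ≠ 0) : ∃ x ∈ s, ∃ n, 0 < n ∧ f^[n] x ∈ s ∧ birkhoffSum f φ n x = 0 := by
  have hzero : ∀ᵐ x ∂μ, ∀ n, φ (f^[n] x) = 0 :=
    ae_all_iff.2 fun n => (hf.iterate n).quasiMeasurePreserving.ae hφ
  obtain ⟨x, hxs, hx, hreturn⟩ := ((frequently_ae_mem_iff.2 hμs).and_eventually
    (hzero.and (hf.conservative.ae_mem_imp_frequently_image_mem hs))).exists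
  obtain ⟨n, hns, hn⟩ := ((hreturn hxs).and_eventually (eventually_gt_atTop 0)).exists
  exact ⟨x, hxs, n, hn, hns, Finset.sum_eq_zero fun i _ => hx i⟩

theorem exists_measurePreserving_of_isPeriodicPt [MeasurableSingletonClass X] {n : ℕ} {p : X}
    (hf : Measurable f) (hn : 0 < n) (hp : f.IsPeriodicPt n p) :
    ∃ ν : Measure X, IsProbabilityMeasure ν ∧ MeasurePreserving f ν ν ∧
      ∀ φ : X → ℝ, ∫ x, φ x ∂ν = (n : ℝ)⁻¹ * birkhoffSum f φ n p := by
  have hn0 : (n : ℝ≥0∞) ≠ 0 := by exact_mod_cast hn.ne'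
  set ν : Measure X := (n : ℝ≥0∞)⁻¹ • ∑ i ∈ Finset.range n, Measure.dirac (f^[i] p) with hν
  refine ⟨ν, ⟨?_⟩, ⟨hf, ?_⟩, fun φ => ?_⟩
  · simp [hν, ENNReal.inv_mul_cancel hn0]
  · obtain ⟨m, rfl⟩ := Nat.exists_eq_add_of_lt hn
    rw [hν, Measure.map_smul, Measure.map_finset_sum hf.aemeasurable]
    simp_rw [Measure.map_dirac' hf, ← Function.iterate_succ_apply']
    rw [Finset.sum_range_succ, hp.eq, Finset.sum_range_succ', Function.iterate_zero_apply]
  · rw [hν, integral_smul_measure, integral_finsetSum_measure fun i _ => integrable_dirac (by simp)]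
    simp [birkhoffSum]

variable [TopologicalSpace X]

theorem measure_compl_eq_zero_iff_support_subset [HereditarilyLindelofSpace X] {μ : Measure X}
    {K : Set X} (hK : IsClosed K) : μ Kᶜ = 0 ↔ μ.support ⊆ K :=
  ⟨fun h => Measure.support_subset_of_isClosed hK (mem_ae_iff.2 h), fun h =>
    measure_mono_null (Set.compl_subset_compl.2 h) Measure.measure_compl_support⟩

theorem exists_isMaxOn_integral [BorelSpace X] [CompactSpace X] [T2Space X]
    [HasOuterApproxClosed X] {φ : X → ℝ} (hf : Continuous f) (hφ : Continuous φ)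
    (hne : {ν : ProbabilityMeasure X | MeasurePreserving f (ν : Measure X) ν}.Nonempty) :
    ∃ μ ∈ {ν : ProbabilityMeasure X | MeasurePreserving f (ν : Measure X) ν},
      IsMaxOn (fun ν : ProbabilityMeasure X => ∫ x, φ x ∂(ν : Measure X))
        {ν | MeasurePreserving f (ν : Measure X) ν} μ := by
  have hclosed : IsClosed {ν : ProbabilityMeasure X | MeasurePreserving f (ν : Measure X) ν} := by
    convert isClosed_eq (ProbabilityMeasure.continuous_map hf) continuous_id using 3 with ν
    exact ⟨fun h => Subtype.ext h.map_eq, fun h => ⟨hf.measurable, congrArg Subtype.val h⟩⟩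
  exact hclosed.isCompact.exists_isMaxOn hne
    (ProbabilityMeasure.continuous_integral_continuousMap (⟨φ, hφ⟩ : C(X, ℝ))).continuousOn

end InvariantMeasures

variable {k : ℕ} {T : Fin k → Fin k → Prop}

section Cylinders

variable {M N n : ℕ} {x y z : Subshift T}

/-- The points `x` and `y` lie in the same cylinder of length `N`. -/
def Agree (N : ℕ) (x y : Subshift T) : Prop := ∀ i < N, x.1 i = y.1 i

theorem Agree.zero (x y : Subshift T) : Agree 0 x y := fun _ hi => absurd hi (Nat.not_lt_zero _)

theorem Agree.refl (N : ℕ) (x : Subshift T) : Agree N x x := fun _ _ => rfl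

theorem Agree.symm (h : Agree N x y) : Agree N y x := fun i hi => (h i hi).symm

theorem Agree.trans (hxy : Agree N x y) (hyz : Agree N y z) : Agree N x z :=
  fun i hi => (hxy i hi).trans (hyz i hi)

theorem Agree.mono (h : Agree N x y) (hMN : M ≤ N) : Agree M x y :=
  fun i hi => h i (hi.trans_le hMN)

theorem iterate_shift_apply (n i : ℕ) (x : Subshift T) : (shift^[n] x).1 i = x.1 (i + n) := by
  induction n generalizing x with
  | zero => rfl
  | succ n ih =>
    rw [Function.iterate_succ_apply, ih, shift]
    simp only [add_assoc]

theorem Agree.iterate_shift (h : Agree (n + N) x y) : Agree N (shift^[n] x) (shift^[n] y) :=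
  fun i hi => by
    rw [iterate_shift_apply, iterate_shift_apply]
    exact h (i + n) (by omega)

theorem Agree.shift (h : Agree N x y) : Agree (N - 1) (shift x) (shift y) :=
  fun i hi => h (i + 1) (by omega)

theorem exists_glue (hN : 0 < N) (h : Agree N (shift^[n] z) y) :
    ∃ w : Subshift T, shift^[n] w = y ∧ Agree (n + N) w z := by
  have hzy : ∀ i < N, z.1 (i + n) = y.1 i := fun i hi => by rw [← h i hi, iterate_shift_apply]
  let w (i : ℕ) : Fin k := if i < n then z.1 i else y.1 (i - n)
  have hwz : ∀ i < n + N, w i = z.1 i := fun i hi => by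
    by_cases hin : i < n
    · exact if_pos hin
    · rw [show w i = y.1 (i - n) from if_neg hin, ← hzy (i - n) (by omega),
        Nat.sub_add_cancel (not_lt.1 hin)]
  have hwy : ∀ i, w (i + n) = y.1 i := fun i => by simp [w]
  refine ⟨⟨w, fun i => ?_⟩, Subtype.ext <| funext fun i => ?_, hwz⟩
  · rcases lt_or_ge i n with hin | hni
    · rw [hwz i (by omega), hwz (i + 1) (by omega)]
      exact z.2 i
    · obtain ⟨j, rfl⟩ := Nat.exists_eq_add_of_le' hni
      rw [hwy, add_right_comm, hwy]
      exact y.2 j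
  · rw [iterate_shift_apply]
    exact hwy i

theorem exists_isPeriodicPt (hn : 0 < n) (hN : 0 < N) (h : Agree N (shift^[n] z) z) :
    ∃ p : Subshift T, shift.IsPeriodicPt n p ∧ Agree (n + N) p z := by
  have hz : ∀ i < N, z.1 (i + n) = z.1 i := fun i hi => by rw [← h i hi, iterate_shift_apply]
  have hmod : ∀ i < n + N, z.1 (i % n) = z.1 i := fun i => by
    induction i using Nat.strong_induction_on with
    | _ i ih =>
      intro hi
      rcases lt_or_ge i n with hin | hni
      · rw [Nat.mod_eq_of_lt hin]
      · rw [Nat.mod_eq_sub_mod hni, ih (i - n) (by omega) (by omega), ← hz (i - n) (by omega),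
          Nat.sub_add_cancel hni]
  refine ⟨⟨fun i => z.1 (i % n), fun i => ?_⟩, Subtype.ext <| funext fun i => ?_, hmod⟩
  · have hlt := Nat.mod_lt i hn
    dsimp only
    rw [← Nat.mod_add_mod i n 1, hmod (i % n + 1) (by omega)]
    exact z.2 (i % n)
  · rw [iterate_shift_apply]
    simp only [Nat.add_mod_right]

theorem isOpen_setOf_agree (N : ℕ) (x : Subshift T) : IsOpen {y | Agree N y x} :=
  (PiNat.isOpen_cylinder _ x.1 N).preimage continuous_subtype_val

theorem eventually_agree (N : ℕ) (x : Subshift T) : ∀ᶠ y in 𝓝 x, Agree N y x :=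
  (isOpen_setOf_agree N x).mem_nhds (Agree.refl N x)

theorem continuous_shift : Continuous (shift : Subshift T → Subshift T) :=
  Continuous.subtype_mk (continuous_pi fun i =>
    (continuous_apply (A := fun _ => Fin k) (i + 1)).comp continuous_subtype_val) _

instance : CompactSpace (Subshift T) := by
  have hclosed : IsClosed {x : ℕ → Fin k | ∀ i, T (x i) (x (i + 1))} := by
    rw [Set.ofPred_forall]
    exact isClosed_iInter fun i =>
      (isClosed_discrete {p : Fin k × Fin k | T p.1 p.2}).preimage
        (f := fun x : ℕ → Fin k => (x i, x (i + 1))) (by fun_prop)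
  exact hclosed.isClosedEmbedding_subtypeVal.compactSpace

instance : SecondCountableTopology (Subshift T) :=
  TopologicalSpace.Subtype.secondCountableTopology {x : ℕ → Fin k | ∀ i, T (x i) (x (i + 1))}

end Cylinders

section Transitivity

/-- Topological transitivity of the shift, with a positive transition time. -/
def IsTopTransitive (T : Fin k → Fin k → Prop) : Prop :=
  ∀ U V : Set (Subshift T), IsOpen U → IsOpen V → U.Nonempty → V.Nonempty →
    ∃ n, 0 < n ∧ (U ∩ shift^[n] ⁻¹' V).Nonempty

theorem IsTopMixing.isTopTransitive (hT : IsTopMixing T) : IsTopTransitive T := by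
  intro U V hU hV hU₀ hV₀
  obtain ⟨N, hN⟩ := hT U V hU hV hU₀ hV₀
  exact ⟨N + 1, N.succ_pos, hN _ N.le_succ⟩

/-- Any point is reached from any one-symbol cylinder in at most `g` steps. This is the uniform form
of transitivity on which the constants of the theorem depend. -/
def ConnectsWithin (T : Fin k → Fin k → Prop) (g : ℕ) : Prop :=
  ∀ x y : Subshift T, ∃ n, 0 < n ∧ n ≤ g ∧ ∃ z, Agree 1 z x ∧ shift^[n] z = y

theorem IsTopTransitive.exists_connectsWithin (hT : IsTopTransitive T) :
    ∃ g, ConnectsWithin T g := by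
  have hsymbols : ∀ p : Fin k × Fin k, ∃ n, ∀ x y : Subshift T, x.1 0 = p.1 → y.1 0 = p.2 →
      0 < n ∧ ∃ z, Agree 1 z x ∧ Agree 1 (shift^[n] z) y := by
    intro p
    by_cases hp : ∃ x y : Subshift T, x.1 0 = p.1 ∧ y.1 0 = p.2
    · obtain ⟨x, y, hx, hy⟩ := hp
      obtain ⟨n, hn, z, hzx, hzy⟩ := hT _ _ (isOpen_setOf_agree 1 x) (isOpen_setOf_agree 1 y)
        ⟨x, Agree.refl _ _⟩ ⟨y, Agree.refl _ _⟩
      refine ⟨n, fun x' y' hx' hy' => ⟨hn, z, hzx.trans fun i hi => ?_,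
        Agree.trans hzy fun i hi => ?_⟩⟩
      · rw [Nat.lt_one_iff.1 hi, hx, hx']
      · rw [Nat.lt_one_iff.1 hi, hy, hy']
    · exact ⟨0, fun x y hx hy => (hp ⟨x, y, hx, hy⟩).elim⟩
  choose n hn using hsymbols
  refine ⟨Finset.univ.sup n, fun x y => ?_⟩
  obtain ⟨hpos, z, hzx, hzy⟩ := hn (x.1 0, y.1 0) x y rfl rfl
  obtain ⟨w, hwy, hwz⟩ := exists_glue one_pos hzy
  exact ⟨_, hpos, Finset.le_sup (Finset.mem_univ _), w, (hwz.mono (by omega)).trans hzx, hwy⟩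

end Transitivity

section Variation

variable {N N₀ n : ℕ} {φ u : Subshift T → ℝ} {H r : ℝ} {x y : Subshift T}

/-- `φ` varies by at most `H * r ^ N` on the cylinders of length `N ≥ N₀`. For `r = lam ^ (-α)` this
is the Hölder condition of exponent `α` at the scales `d(x, y) ≤ lam ^ (-N₀)`. -/
def HasExpVariation (N₀ : ℕ) (φ : Subshift T → ℝ) (H r : ℝ) : Prop :=
  ∀ ⦃N⦄, N₀ ≤ N → ∀ ⦃x y⦄, Agree N x y → |φ x - φ y| ≤ H * r ^ N

theorem exists_mul_pow_lt (hr : r ∈ Set.Ico 0 1) (D : ℝ) {ε : ℝ} (hε : 0 < ε) (M : ℕ) :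
    ∃ N, M < N ∧ D * r ^ N < ε := by
  have htendsto : Tendsto (fun N => D * r ^ N) atTop (𝓝 0) := by
    simpa using (tendsto_pow_atTop_nhds_zero_of_lt_one hr.1 hr.2).const_mul D
  exact ((eventually_gt_atTop M).and (htendsto.eventually_lt_const hε)).exists

theorem HasExpVariation.continuous (hφ : HasExpVariation N₀ φ H r) (hr : r ∈ Set.Ico 0 1) :
    Continuous φ := by
  refine continuous_iff_continuousAt.2 fun x => Metric.tendsto_nhds.2 fun ε hε => ?_
  obtain ⟨N, hN, hlt⟩ := exists_mul_pow_lt hr H hε N₀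
  filter_upwards [eventually_agree N x] with y hy
  exact (hφ hN.le hy).trans_lt hlt

theorem HasExpVariation.integrable {μ : Measure (Subshift T)} [IsFiniteMeasure μ]
    (hφ : HasExpVariation N₀ φ H r) (hr : r ∈ Set.Ico 0 1) : Integrable φ μ :=
  (hφ.continuous hr).integrable_of_hasCompactSupport (HasCompactSupport.of_compactSpace φ)

theorem HasExpVariation.nonneg [Nonempty (Subshift T)] (hφ : HasExpVariation 0 φ H r) : 0 ≤ H := by
  obtain ⟨x⟩ := ‹Nonempty (Subshift T)›
  simpa using hφ le_rfl (Agree.refl 0 x)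

theorem HasExpVariation.comp_shift (hu : HasExpVariation 0 u H r) (hr : r ∈ Set.Ioo 0 1) :
    HasExpVariation 0 (u ∘ shift) (H / r) r := by
  intro N _ x y hxy
  have : Nonempty (Subshift T) := ⟨x⟩
  have hr0 := hr.1
  have hH := hu.nonneg
  calc |u (shift x) - u (shift y)| ≤ H * r ^ (N - 1) :=
        hu (Nat.zero_le _) hxy.shift
    _ = H / r * r ^ (N - 1 + 1) := by
      rw [pow_succ']
      field_simp
    _ ≤ H / r * r ^ N := by
      gcongr ?_ * ?_
      exact pow_le_pow_of_le_one hr.1.le hr.2.le (by omega)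

theorem HasExpVariation.addCoboundary {K : ℝ} (hφ : HasExpVariation 0 φ H r)
    (hu : HasExpVariation 0 u K r) (hr : r ∈ Set.Ioo 0 1) :
    HasExpVariation 0 (addCoboundary shift φ u) (H + K + K / r) r := by
  intro N hN x y hxy
  calc |SFTMax.addCoboundary shift φ u x - SFTMax.addCoboundary shift φ u y|
      = |(φ x - φ y) + (u x - u y) - ((u ∘ shift) x - (u ∘ shift) y)| := by
        congr 1
        simp only [SFTMax.addCoboundary, Function.comp_apply]
        ring
    _ ≤ |φ x - φ y| + |u x - u y| + |(u ∘ shift) x - (u ∘ shift) y| :=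
        (abs_sub _ _).trans (by gcongr; exact abs_add_le _ _)
    _ ≤ H * r ^ N + K * r ^ N + K / r * r ^ N :=
        add_le_add_three (hφ hN hxy) (hu hN hxy) (hu.comp_shift hr hN hxy)
    _ = (H + K + K / r) * r ^ N := by ring

theorem HasExpVariation.abs_birkhoffSum_sub_le (hφ : HasExpVariation 0 φ H r)
    (hr : r ∈ Set.Ico 0 1) (hxy : Agree (n + N) x y) :
    |birkhoffSum shift φ n x - birkhoffSum shift φ n y| ≤ H / (1 - r) * r ^ N := by
  have : Nonempty (Subshift T) := ⟨x⟩
  have hterm : ∀ i ∈ Finset.range n,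
      |φ (shift^[i] x) - φ (shift^[i] y)| ≤ H * r ^ (n - 1 - i + N) := fun i hi =>
    hφ (Nat.zero_le _) (Agree.iterate_shift (hxy.mono (by have := Finset.mem_range.1 hi; omega)))
  calc |birkhoffSum shift φ n x - birkhoffSum shift φ n y|
      = |∑ i ∈ Finset.range n, (φ (shift^[i] x) - φ (shift^[i] y))| := by
        rw [birkhoffSum, birkhoffSum, Finset.sum_sub_distrib]
    _ ≤ ∑ i ∈ Finset.range n, H * r ^ (n - 1 - i + N) :=
        (Finset.abs_sum_le_sum_abs _ _).trans (Finset.sum_le_sum hterm)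
    _ = H * r ^ N * ∑ i ∈ Finset.Ico 0 n, r ^ i := by
        rw [Finset.sum_range_reflect (fun i => H * r ^ (i + N)), Finset.mul_sum,
          Finset.range_eq_Ico]
        exact Finset.sum_congr rfl fun i _ => by ring
    _ ≤ H * r ^ N * (r ^ 0 / (1 - r)) :=
        mul_le_mul_of_nonneg_left (geom_sum_Ico_le_of_lt_one hr.1 hr.2)
          (mul_nonneg hφ.nonneg (pow_nonneg hr.1 N))
    _ = H / (1 - r) * r ^ N := by ring

end Variation

section Segments

variable {φ : Subshift T → ℝ} {H r a b : ℝ} {M M' N m n : ℕ} {x y z : Subshift T}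

/-- Some orbit segment of length `n`, along which `φ` sums to at least `c`, ends at `y` and starts
in the cylinder of length `M` of `x`. These are the building blocks of the action. -/
def HasSegment (φ : Subshift T → ℝ) (M n : ℕ) (x y : Subshift T) (c : ℝ) : Prop :=
  ∃ z, shift^[n] z = y ∧ Agree M z x ∧ c ≤ birkhoffSum shift φ n z

theorem HasSegment.mono (h : HasSegment φ M n x y a) (hM : M' ≤ M) (hba : b ≤ a) :
    HasSegment φ M' n x y b :=
  let ⟨z, hzy, hzx, hz⟩ := h
  ⟨z, hzy, hzx.mono hM, hba.trans hz⟩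

theorem HasSegment.trans (hφ : HasExpVariation 0 φ H r) (hr : r ∈ Set.Ico 0 1) (hN : 0 < N)
    (hM : M ≤ n + N) (hxy : HasSegment φ M n x y a) (hyz : HasSegment φ N m y z b) :
    HasSegment φ M (n + m) x z (a + b - H / (1 - r) * r ^ N) := by
  obtain ⟨w, rfl, hwx, hw⟩ := hxy
  obtain ⟨v, rfl, hvw, hv⟩ := hyz
  obtain ⟨u, rfl, huw⟩ := exists_glue hN hvw.symm
  refine ⟨u, by rw [add_comm, Function.iterate_add_apply], (huw.mono hM).trans hwx, ?_⟩
  rw [birkhoffSum_add]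
  linarith [(abs_le.1 (hφ.abs_birkhoffSum_sub_le hr huw)).1]

theorem HasSegment.exists_isPeriodicPt (hφ : HasExpVariation 0 φ H r) (hr : r ∈ Set.Ico 0 1)
    (hn : 0 < n) (hN : 0 < N) (h : HasSegment φ N n x x a) :
    ∃ p, shift.IsPeriodicPt n p ∧ a - H / (1 - r) * r ^ N ≤ birkhoffSum shift φ n p := by
  obtain ⟨z, rfl, hz, ha⟩ := h
  obtain ⟨p, hp, hpz⟩ := SFTMax.exists_isPeriodicPt hn hN hz.symm
  exact ⟨p, hp, by linarith [(abs_le.1 (hφ.abs_birkhoffSum_sub_le hr hpz)).1]⟩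

theorem ConnectsWithin.exists_hasSegment {g : ℕ} (hT : ConnectsWithin T g)
    (hφ : ∀ x, |φ x| ≤ b) (x y : Subshift T) : ∃ n, 0 < n ∧ HasSegment φ 1 n x y (-(g * b)) := by
  obtain ⟨n, hn, hng, z, hzx, hzy⟩ := hT x y
  have hb : 0 ≤ b := (abs_nonneg _).trans (hφ x)
  have hng' : n * b ≤ g * b := by gcongr
  exact ⟨n, hn, z, hzy, hzx, by linarith [(abs_le.1 (abs_birkhoffSum_le (f := shift) hφ n z)).1]⟩

theorem birkhoffSum_le_of_isPeriodicPt {g : ℕ} (hT : ConnectsWithin T g)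
    (hφ : HasExpVariation 0 φ H r) (hr : r ∈ Set.Ico 0 1) (hb : ∀ x, |φ x| ≤ b)
    (hper : ∀ ⦃n p⦄, 0 < n → shift.IsPeriodicPt n p → birkhoffSum shift φ n p ≤ 0)
    (n : ℕ) (z : Subshift T) : birkhoffSum shift φ n z ≤ 2 * (H / (1 - r)) + g * b := by
  have : Nonempty (Subshift T) := ⟨z⟩
  have hD : 0 ≤ H / (1 - r) := div_nonneg hφ.nonneg (sub_nonneg.2 hr.2.le)
  obtain ⟨m, hm, hback⟩ := hT.exists_hasSegment hb (shift^[n] z) z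
  have hloop := HasSegment.trans hφ hr one_pos (by omega) ⟨z, rfl, Agree.refl 1 z, le_rfl⟩ hback
  obtain ⟨p, hp, hle⟩ := hloop.exists_isPeriodicPt hφ hr (by omega) one_pos
  have hDr : H / (1 - r) * r ^ 1 ≤ H / (1 - r) := mul_le_of_le_one_right hD (by simpa using hr.2.le)
  linarith [hper (by omega) hp]

end Segments

section Action

variable {φ : Subshift T → ℝ} {H r Q a b c : ℝ} {L L' : ℕ} {x y z : Subshift T}

/-- From arbitrarily near `x`, orbit segments longer than `L` along which `φ` sums to almost `c` or
more lead to `y`. For `L = 0` this says that the action potential from `x` to `y` is at least `c`,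
and it spares the arithmetic of `[-∞, ∞]`; large `L` lets one follow `x` for a long time first. -/
def ActionGE (φ : Subshift T → ℝ) (L : ℕ) (x y : Subshift T) (c : ℝ) : Prop :=
  ∀ ⦃c'⦄, c' < c → ∀ M, ∃ n, L < n ∧ HasSegment φ M n x y c'

theorem ActionGE.mono (h : ActionGE φ L x y a) (hL : L' ≤ L) (hba : b ≤ a) :
    ActionGE φ L' x y b := fun _ hc M =>
  let ⟨n, hn, hseg⟩ := h (hc.trans_le hba) M
  ⟨n, hL.trans_lt hn, hseg⟩

theorem ActionGE.of_forall_lt (h : ∀ c < a, ActionGE φ L x y c) : ActionGE φ L x y a :=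
  fun _ hc M => let ⟨_, hcb, hba⟩ := exists_between hc; h _ hba hcb M

theorem ActionGE.le (hQ : ∀ n z, birkhoffSum shift φ n z ≤ Q) (h : ActionGE φ L x y c) : c ≤ Q :=
  le_of_forall_lt_imp_le_of_dense fun _ hc =>
    let ⟨n, _, z, _, _, hz⟩ := h hc 0
    hz.trans (hQ n z)

theorem ActionGE.trans (hφ : HasExpVariation 0 φ H r) (hr : r ∈ Set.Ico 0 1)
    (hxy : ActionGE φ L x y a) (hyz : ActionGE φ L' y z b) :
    ActionGE φ (L + L' + 1) x z (a + b) := by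
  intro c hc M
  have hε : 0 < (a + b - c) / 3 := by linarith
  obtain ⟨N, hMN, hN⟩ := exists_mul_pow_lt hr (H / (1 - r)) hε M
  obtain ⟨n, hn, hseg⟩ := hxy (sub_lt_self a hε) M
  obtain ⟨m, hm, hseg'⟩ := hyz (sub_lt_self b hε) N
  exact ⟨n + m, by omega,
    (hseg.trans hφ hr (by omega) (by omega) hseg').mono le_rfl (by linarith)⟩

theorem ActionGE.self_nonpos (hφ : HasExpVariation 0 φ H r) (hr : r ∈ Set.Ico 0 1)
    (hQ : ∀ n z, birkhoffSum shift φ n z ≤ Q) (h : ActionGE φ 0 x x c) : c ≤ 0 := by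
  have hmul : ∀ j : ℕ, ActionGE φ 0 x x ((j + 1) * c) := fun j => by
    induction j with
    | zero => simpa using h
    | succ j ih => exact (ih.trans hφ hr h).mono (by omega) (by push_cast; linarith)
  by_contra! hc
  obtain ⟨j, hj⟩ := exists_nat_gt (Q / c)
  rw [div_lt_iff₀ hc] at hj
  linarith [(hmul j).le hQ]

theorem actionGE_shift (φ : Subshift T → ℝ) (y : Subshift T) : ActionGE φ 0 y (shift y) (φ y) :=
  fun _ hc M => ⟨1, one_pos, y, rfl, Agree.refl M y, by simpa using hc.le⟩

theorem ActionGE.from_shift (hφ : HasExpVariation 0 φ H r) (hr : r ∈ Set.Ico 0 1)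
    (h : ActionGE φ (L + 1) x y c) : ActionGE φ L (shift x) y (c - φ x) := by
  intro c' hc M
  have hε : 0 < (c - φ x - c') / 2 := by linarith
  obtain ⟨N, hMN, hN⟩ := exists_mul_pow_lt hr H hε M
  obtain ⟨n, hn, z, hzy, hzx, hz⟩ := h (sub_lt_self c hε) N
  obtain ⟨m, rfl⟩ : ∃ m, n = m + 1 := ⟨n - 1, by omega⟩
  refine ⟨m, by omega, shift z, hzy, hzx.shift.mono (by omega), ?_⟩
  rw [birkhoffSum_succ'] at hz
  linarith [(abs_le.1 (hφ (Nat.zero_le N) hzx)).2]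

end Action

section AubrySet

variable {φ : Subshift T → ℝ} {H r a b c : ℝ} {N m : ℕ} {x y z : Subshift T}

/-- The set of the points at which the self-action of `φ` is at least `0`, an analogue of the
projected Aubry set of Lagrangian dynamics; for `φ = A - m(A)` it is `𝔖`. -/
def aubrySet (φ : Subshift T → ℝ) : Set (Subshift T) := {x | ActionGE φ 0 x x 0}

theorem mem_aubrySet_of_forall_exists_return (hφ : HasExpVariation 0 φ H r) (hr : r ∈ Set.Ico 0 1)
    (h : ∀ N, ∀ ε > 0, ∃ n, 0 < n ∧ ∃ y, Agree N y x ∧ HasSegment φ N n x y (-ε)) :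
    x ∈ aubrySet φ := by
  intro c hc M
  have hε : 0 < -c / 2 := by linarith
  obtain ⟨N, hMN, hN⟩ := exists_mul_pow_lt hr (H / (1 - r)) hε M
  obtain ⟨n, hn, y, hyx, hseg⟩ := h N _ hε
  have hstay : HasSegment φ N 0 y x 0 := ⟨x, rfl, hyx.symm, by simp⟩
  exact ⟨n + 0, hn, (hseg.trans hφ hr (by omega) (by omega) hstay).mono hMN.le (by linarith)⟩

theorem isClosed_aubrySet (hφ : HasExpVariation 0 φ H r) (hr : r ∈ Set.Ico 0 1) :
    IsClosed (aubrySet φ) := by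
  refine isClosed_of_closure_subset fun x hx => mem_aubrySet_of_forall_exists_return hφ hr ?_
  intro N ε hε
  obtain ⟨y, hyx, hy⟩ := mem_closure_iff.1 hx _ (isOpen_setOf_agree N x) (Agree.refl N x)
  obtain ⟨n, hn, z, hzy, hz, hsum⟩ := hy (neg_neg_of_pos hε) N
  exact ⟨n, hn, y, hyx, z, hzy, hz.trans hyx, hsum⟩

theorem ActionGE.of_mem_aubrySet (hφ : HasExpVariation 0 φ H r) (hr : r ∈ Set.Ico 0 1)
    (hx : x ∈ aubrySet φ) (h : ActionGE φ 0 x y c) (L : ℕ) : ActionGE φ L x y c := by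
  induction L with
  | zero => exact h
  | succ L ih => exact (ActionGE.trans hφ hr hx ih).mono (by omega) (by simp)

theorem actionGE_shift_self (hφ : HasExpVariation 0 φ H r) (hr : r ∈ Set.Ico 0 1)
    (hx : x ∈ aubrySet φ) : ActionGE φ 0 (shift x) x (-φ x) := by
  simpa using ActionGE.from_shift hφ hr (ActionGE.of_mem_aubrySet hφ hr hx hx 1)

theorem mapsTo_shift_aubrySet (hφ : HasExpVariation 0 φ H r) (hr : r ∈ Set.Ico 0 1) :
    Set.MapsTo shift (aubrySet φ) (aubrySet φ) := fun x hx =>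
  ((actionGE_shift_self hφ hr hx).trans hφ hr (actionGE_shift φ x)).mono (by omega) (by simp)

theorem ActionGE.trans_hasSegment (hφ : HasExpVariation 0 φ H r) (hr : r ∈ Set.Ico 0 1)
    (hx : x ∈ aubrySet φ) (hxy : ActionGE φ 0 x y a) (hN : 0 < N) (hyz : HasSegment φ N m y z b) :
    ActionGE φ 0 x z (a + b - H / (1 - r) * r ^ N) := by
  intro c hc M
  obtain ⟨n, hn, hseg⟩ := hxy.of_mem_aubrySet hφ hr hx M
    (show c - b + H / (1 - r) * r ^ N < a by linarith) M
  exact ⟨n + m, by omega, (hseg.trans hφ hr hN (by omega) hyz).mono le_rfl (by linarith)⟩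

end AubrySet

section PastSup

variable {φ : Subshift T → ℝ} {H r Q c : ℝ} {y : Subshift T}

/-- The supremum of the sums of `φ` along the orbit segments, possibly empty, that end at `y`. It is
a sub-action of `φ` whose construction needs no point of zero self-action. -/
noncomputable def pastSup (φ : Subshift T → ℝ) (y : Subshift T) : ℝ :=
  ⨆ p : {p : ℕ × Subshift T // shift^[p.1] p.2 = y}, birkhoffSum shift φ p.1.1 p.1.2

theorem birkhoffSum_le_pastSup (hQ : ∀ n z, birkhoffSum shift φ n z ≤ Q) (n : ℕ) (z : Subshift T) :
    birkhoffSum shift φ n z ≤ pastSup φ (shift^[n] z) :=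
  le_ciSup (f := fun p : {p : ℕ × Subshift T // shift^[p.1] p.2 = shift^[n] z} =>
    birkhoffSum shift φ p.1.1 p.1.2) ⟨Q, Set.forall_mem_range.2 fun _ => hQ _ _⟩ ⟨(n, z), rfl⟩

theorem pastSup_le (h : ∀ n z, shift^[n] z = y → birkhoffSum shift φ n z ≤ c) :
    pastSup φ y ≤ c :=
  have : Nonempty {p : ℕ × Subshift T // shift^[p.1] p.2 = y} := ⟨⟨(0, y), rfl⟩⟩
  ciSup_le fun p => h _ _ p.2

theorem addCoboundary_pastSup_nonpos (hQ : ∀ n z, birkhoffSum shift φ n z ≤ Q) (y : Subshift T) :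
    addCoboundary shift φ (pastSup φ) y ≤ 0 := by
  have hstep : pastSup φ y ≤ pastSup φ (shift y) - φ y := by
    refine pastSup_le ?_
    rintro n z rfl
    have hsucc := birkhoffSum_le_pastSup hQ (n + 1) z
    rw [birkhoffSum_succ, Function.iterate_succ_apply'] at hsucc
    linarith
  rw [addCoboundary]
  linarith

theorem hasExpVariation_pastSup (hφ : HasExpVariation 0 φ H r) (hr : r ∈ Set.Ico 0 1)
    (hQ : ∀ n z, birkhoffSum shift φ n z ≤ Q) :
    HasExpVariation 1 (pastSup φ) (H / (1 - r)) r := by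
  have hle : ∀ ⦃N⦄, 1 ≤ N → ∀ ⦃x y⦄, Agree N x y →
      pastSup φ x ≤ pastSup φ y + H / (1 - r) * r ^ N := fun N hN x y hxy => by
    refine pastSup_le ?_
    rintro n z rfl
    obtain ⟨w, rfl, hwz⟩ := exists_glue hN hxy
    linarith [birkhoffSum_le_pastSup hQ n w, (abs_le.1 (hφ.abs_birkhoffSum_sub_le hr hwz)).1]
  intro N hN x y hxy
  rw [abs_sub_le_iff]
  constructor <;> linarith [hle hN hxy, hle hN hxy.symm]

theorem support_subset_aubrySet {μ : Measure (Subshift T)} [IsFiniteMeasure μ]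
    (hφ : HasExpVariation 0 φ H r) (hr : r ∈ Set.Ico 0 1)
    (hQ : ∀ n z, birkhoffSum shift φ n z ≤ Q) (hμ : MeasurePreserving shift μ μ)
    (hint : ∫ x, φ x ∂μ = 0) : μ.support ⊆ aubrySet φ := by
  have hu := hasExpVariation_pastSup hφ hr hQ
  have hB : addCoboundary shift φ (pastSup φ) =ᵐ[μ] 0 := by
    have hBint : Integrable (addCoboundary shift φ (pastSup φ)) μ :=
      ((hφ.integrable hr).add (hu.integrable hr)).sub
        (hμ.integrable_comp_of_integrable (hu.integrable hr))
    have hB0 : ∫ x, addCoboundary shift φ (pastSup φ) x ∂μ = 0 := by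
      rw [integral_addCoboundary hμ (hφ.integrable hr) (hu.integrable hr), hint]
    have hneg := (integral_eq_zero_iff_of_nonneg (f := -addCoboundary shift φ (pastSup φ))
      (fun x => neg_nonneg.2 (addCoboundary_pastSup_nonpos hQ x)) hBint.neg).1
      ((integral_neg _).trans (by rw [hB0, neg_zero]))
    simpa using hneg.neg
  refine fun x hx => mem_aubrySet_of_forall_exists_return hφ hr fun M ε hε => ?_
  obtain ⟨N, hMN, hN⟩ := exists_mul_pow_lt hr (H / (1 - r)) hε M
  obtain ⟨p, hp, n, hn, hnp, hsum⟩ := exists_return_birkhoffSum_eq_zero hμ hB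
    (isOpen_setOf_agree N x).measurableSet.nullMeasurableSet
    ((Measure.mem_support_iff_forall x).1 hx _ (eventually_agree N x)).ne'
  rw [birkhoffSum_addCoboundary] at hsum
  refine ⟨n, hn, _, hnp.mono hMN.le, p, rfl, hp.mono hMN.le, ?_⟩
  linarith [(abs_le.1 (hu (by omega) (hp.trans hnp.symm))).2]

end PastSup

section ActionFrom

variable {φ W : Subshift T → ℝ} {H r Q b : ℝ} {x y z : Subshift T}

/-- The action potential of `φ` from `x` takes finite values only, and `W` is this potential. -/
def IsActionFrom (φ : Subshift T → ℝ) (x : Subshift T) (W : Subshift T → ℝ) : Prop :=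
  ∀ ⦃y c⦄, ActionGE φ 0 x y c ↔ c ≤ W y

theorem exists_isActionFrom (hQ : ∀ n z, birkhoffSum shift φ n z ≤ Q)
    (hb : ∀ y, ActionGE φ 0 x y b) : ∃ W, IsActionFrom φ x W := by
  refine ⟨fun y => sSup {c | ActionGE φ 0 x y c}, fun y c => ⟨fun h => ?_, fun h => ?_⟩⟩
  · exact le_csSup ⟨Q, fun _ h => h.le hQ⟩ h
  · refine ActionGE.of_forall_lt fun c' hc => ?_
    obtain ⟨c'', hc'', hlt⟩ := exists_lt_of_lt_csSup ⟨b, hb y⟩ (hc.trans_le h)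
    exact ActionGE.mono hc'' le_rfl hlt.le

theorem ConnectsWithin.actionGE {g : ℕ} (hT : ConnectsWithin T g) (hφ : HasExpVariation 0 φ H r)
    (hr : r ∈ Set.Ico 0 1) (hb : ∀ x, |φ x| ≤ b) (hx : x ∈ aubrySet φ) (y : Subshift T) :
    ActionGE φ 0 x y (-(g * b) - H / (1 - r) * r) := by
  obtain ⟨n, -, hseg⟩ := hT.exists_hasSegment hb x y
  simpa using ActionGE.trans_hasSegment hφ hr hx hx one_pos hseg

namespace IsActionFrom

theorem add_le (hW : IsActionFrom φ x W) (hφ : HasExpVariation 0 φ H r) (hr : r ∈ Set.Ico 0 1)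
    (hyz : ActionGE φ 0 y z c) : W y + c ≤ W z :=
  hW.1 (((hW.2 le_rfl).trans hφ hr hyz).mono (by omega) le_rfl)

theorem addCoboundary_nonpos (hW : IsActionFrom φ x W) (hφ : HasExpVariation 0 φ H r)
    (hr : r ∈ Set.Ico 0 1) (y : Subshift T) : addCoboundary shift φ W y ≤ 0 := by
  rw [addCoboundary]
  linarith [hW.add_le hφ hr (actionGE_shift φ y)]

theorem addCoboundary_eq_zero (hW : IsActionFrom φ x W) (hφ : HasExpVariation 0 φ H r)
    (hr : r ∈ Set.Ico 0 1) (hy : y ∈ aubrySet φ) : addCoboundary shift φ W y = 0 := by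
  refine (hW.addCoboundary_nonpos hφ hr y).antisymm ?_
  rw [addCoboundary]
  linarith [hW.add_le hφ hr (actionGE_shift_self hφ hr hy)]

theorem hasExpVariation_one (hW : IsActionFrom φ x W) (hφ : HasExpVariation 0 φ H r)
    (hr : r ∈ Set.Ico 0 1) (hx : x ∈ aubrySet φ) : HasExpVariation 1 W (H / (1 - r)) r := by
  have hle : ∀ ⦃N⦄, 1 ≤ N → ∀ ⦃y z⦄, Agree N y z → W y - H / (1 - r) * r ^ N ≤ W z :=
    fun N hN y z hyz => hW.1 <| by
      simpa using (hW.2 le_rfl).trans_hasSegment hφ hr hx hN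
        (show HasSegment φ N 0 y z 0 from ⟨z, rfl, hyz.symm, by simp⟩)
  intro N hN y z hyz
  rw [abs_sub_le_iff]
  constructor <;> linarith [hle hN hyz, hle hN hyz.symm]

theorem hasExpVariation_zero {g : ℕ} (hW : IsActionFrom φ x W) (hT : ConnectsWithin T g)
    (hφ : HasExpVariation 0 φ H r) (hr : r ∈ Set.Ico 0 1) (hb : ∀ x, |φ x| ≤ b)
    (hQ : ∀ n z, birkhoffSum shift φ n z ≤ Q) (hx : x ∈ aubrySet φ) :
    HasExpVariation 0 W (Q + g * b + H / (1 - r)) r := by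
  have : Nonempty (Subshift T) := ⟨x⟩
  have hD : 0 ≤ H / (1 - r) := div_nonneg hφ.nonneg (sub_nonneg.2 hr.2.le)
  have hQ0 : 0 ≤ Q := by simpa using hQ 0 x
  have hgb : 0 ≤ g * b := mul_nonneg g.cast_nonneg ((abs_nonneg _).trans (hb x))
  intro N _ y z hyz
  rcases N.eq_zero_or_pos with rfl | hN
  · have hDr := mul_le_of_le_one_right hD hr.2.le
    have hlower : ∀ y, -(g * b) - H / (1 - r) ≤ W y := fun y =>
      (by linarith : _ ≤ _).trans (hW.1 (hT.actionGE hφ hr hb hx y))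
    have hupper : ∀ y, W y ≤ Q := fun y => ActionGE.le hQ (hW.2 le_rfl)
    rw [pow_zero, mul_one, abs_sub_le_iff]
    constructor <;> linarith [hlower y, hlower z, hupper y, hupper z]
  · exact (hW.hasExpVariation_one hφ hr hx hN hyz).trans
      (mul_le_mul_of_nonneg_right (by linarith) (pow_nonneg hr.1 N))

end IsActionFrom

end ActionFrom

section Holder

variable {f : Subshift T → ℝ} {lam α c : ℝ} {N N₀ : ℕ} {x y : Subshift T}

theorem symDist_self (x : Subshift T) : symDist lam x x = 0 := if_pos rfl

theorem symDist_of_ne (hxy : x ≠ y) : symDist lam x y = (lam ^ PiNat.firstDiff x.1 y.1)⁻¹ :=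
  if_neg hxy

theorem symDist_pos (hlam : 1 < lam) (hxy : x ≠ y) : 0 < symDist lam x y := by
  rw [symDist_of_ne hxy]
  positivity

theorem agree_iff_le_firstDiff (hxy : x ≠ y) : Agree N x y ↔ N ≤ PiNat.firstDiff x.1 y.1 :=
  PiNat.mem_cylinder_iff_le_firstDiff (Subtype.coe_ne_coe.2 hxy) N

theorem symDist_le_iff (hlam : 1 < lam) : symDist lam x y ≤ (lam ^ N)⁻¹ ↔ Agree N x y := by
  have hpow : ∀ n : ℕ, 0 < lam ^ n := fun n => by positivity
  rcases eq_or_ne x y with rfl | hxy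
  · simp only [symDist_self, Agree.refl, inv_nonneg, (hpow N).le]
  · rw [symDist_of_ne hxy, inv_le_inv₀ (hpow _) (hpow _), pow_le_pow_iff_right₀ hlam,
      agree_iff_le_firstDiff hxy]

theorem symDist_rpow (hlam : 0 ≤ lam) (hxy : x ≠ y) :
    symDist lam x y ^ α = (lam ^ α)⁻¹ ^ PiNat.firstDiff x.1 y.1 := by
  rw [symDist_of_ne hxy, Real.inv_rpow (pow_nonneg hlam _), inv_pow, Real.rpow_pow_comm hlam]

theorem inv_rpow_mem_Ioo (hlam : 1 < lam) (hα : 0 < α) : (lam ^ α)⁻¹ ∈ Set.Ioo 0 1 :=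
  ⟨inv_pos.2 (Real.rpow_pos_of_pos (by linarith) α),
    inv_lt_one_of_one_lt₀ (Real.one_lt_rpow hlam hα)⟩

theorem holdUpTo_le_ofReal_iff (hlam : 1 < lam) (hα : 0 < α) (hc : 0 ≤ c) :
    holdUpTo lam α (lam ^ N₀)⁻¹ f ≤ ENNReal.ofReal c ↔ HasExpVariation N₀ f c (lam ^ α)⁻¹ := by
  have hr := inv_rpow_mem_Ioo hlam hα
  simp only [holdUpTo, iSup_le_iff, ENNReal.ofReal_le_ofReal_iff hc]
  constructor
  · intro h N hN x y hxy
    rcases eq_or_ne x y with rfl | hne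
    · simpa using mul_nonneg hc (pow_nonneg hr.1.le N)
    · have hd := symDist_pos hlam hne
      have hle := h x y ⟨hd, (symDist_le_iff hlam).2 (hxy.mono hN)⟩
      rw [div_le_iff₀ (Real.rpow_pos_of_pos hd α)] at hle
      refine hle.trans (mul_le_mul_of_nonneg_left ?_ hc)
      rw [symDist_rpow (by linarith) hne]
      exact pow_le_pow_of_le_one hr.1.le hr.2.le ((agree_iff_le_firstDiff hne).1 hxy)
  · rintro h x y ⟨hd, hle⟩
    have hne : x ≠ y := by
      rintro rfl
      exact hd.ne' (symDist_self x)
    rw [div_le_iff₀ (Real.rpow_pos_of_pos hd α), symDist_rpow (by linarith) hne]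
    exact h ((agree_iff_le_firstDiff hne).1 ((symDist_le_iff hlam).1 hle))
      ((agree_iff_le_firstDiff hne).2 le_rfl)

theorem hold_le_ofReal_iff (hlam : 1 < lam) (hα : 0 < α) (hc : 0 ≤ c) :
    hold lam α f ≤ ENNReal.ofReal c ↔ HasExpVariation 0 f c (lam ^ α)⁻¹ := by
  simpa [hold] using holdUpTo_le_ofReal_iff (N₀ := 0) (f := f) hlam hα hc

theorem IsHolder.hasExpVariation (hlam : 1 < lam) (hα : 0 < α) (hf : IsHolder lam α f) :
    HasExpVariation 0 f (hold lam α f).toReal (lam ^ α)⁻¹ :=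
  (hold_le_ofReal_iff hlam hα ENNReal.toReal_nonneg).1 (ENNReal.ofReal_toReal hf.ne).ge

theorem HasExpVariation.isHolder [Nonempty (Subshift T)] (hlam : 1 < lam) (hα : 0 < α)
    (hf : HasExpVariation 0 f c (lam ^ α)⁻¹) : IsHolder lam α f :=
  ((hold_le_ofReal_iff hlam hα hf.nonneg).2 hf).trans_lt ENNReal.ofReal_lt_top

theorem HasExpVariation.holdUpTo_le_mul_hold {A : Subshift T → ℝ} (hlam : 1 < lam) (hα : 0 < α)
    (hA : IsHolder lam α A) (hc : 0 ≤ c)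
    (hf : HasExpVariation N₀ f (c * (hold lam α A).toReal) (lam ^ α)⁻¹) :
    holdUpTo lam α (lam ^ N₀)⁻¹ f ≤ c.toNNReal * hold lam α A :=
  calc holdUpTo lam α (lam ^ N₀)⁻¹ f ≤ ENNReal.ofReal (c * (hold lam α A).toReal) :=
        (holdUpTo_le_ofReal_iff hlam hα (mul_nonneg hc ENNReal.toReal_nonneg)).2 hf
    _ = c.toNNReal * hold lam α A := by
        rw [ENNReal.ofReal_mul hc, ENNReal.ofReal_toReal hA.ne, ENNReal.ofReal]

end Holder

section MaximizingMeasures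

variable {A W : Subshift T → ℝ} {H Q r : ℝ} {g : ℕ} {x : Subshift T}
  {μ ν : Measure (Subshift T)}

/-- The normalization `A - m(A)` of the observable, whose Birkhoff sums define the action. -/
noncomputable def centered (A : Subshift T → ℝ) (x : Subshift T) : ℝ := A x - maxMean A

theorem HasExpVariation.centered (hA : HasExpVariation 0 A H r) :
    HasExpVariation 0 (centered A) H r := by
  simpa only [HasExpVariation, SFTMax.centered, sub_sub_sub_cancel_right] using hA

theorem exists_isInvProb [hne : Nonempty (Subshift T)] (hT : IsTopTransitive T) :
    ∃ ν : Measure (Subshift T), IsInvProb ν := by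
  obtain ⟨x⟩ := hne
  obtain ⟨g, hg⟩ := hT.exists_connectsWithin
  obtain ⟨n, hn, -, z, hzx, rfl⟩ := hg x x
  obtain ⟨p, hp, -⟩ := exists_isPeriodicPt hn one_pos hzx.symm
  obtain ⟨ν, hν, hshift, -⟩ :=
    exists_measurePreserving_of_isPeriodicPt continuous_shift.measurable hn hp
  exact ⟨ν, hν, hshift⟩

theorem isGreatest_maxMean [Nonempty (Subshift T)] (hT : IsTopTransitive T) (hA : Continuous A) :
    IsGreatest {r : ℝ | ∃ ν : Measure (Subshift T), IsInvProb ν ∧ ∫ x, A x ∂ν = r} (maxMean A) := by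
  obtain ⟨ν, hν⟩ := exists_isInvProb hT
  obtain ⟨μ, hμ, hmax⟩ := exists_isMaxOn_integral continuous_shift hA ⟨⟨ν, hν.1⟩, hν.2⟩
  have hgreatest : IsGreatest
      {r : ℝ | ∃ ν : Measure (Subshift T), IsInvProb ν ∧ ∫ x, A x ∂ν = r} (∫ x, A x ∂μ) := by
    refine ⟨⟨μ, ⟨inferInstance, hμ⟩, rfl⟩, ?_⟩
    rintro _ ⟨ν, hν, rfl⟩
    exact hmax (a := ⟨ν, hν.1⟩) hν.2
  rwa [maxMean, hgreatest.csSup_eq]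

theorem integral_centered [IsProbabilityMeasure μ] (hA : Integrable A μ) :
    ∫ x, centered A x ∂μ = ∫ x, A x ∂μ - maxMean A := by
  simp [centered, integral_sub hA (integrable_const _)]

theorem abs_centered_le [Nonempty (Subshift T)] (hT : IsTopTransitive T)
    (hA : HasExpVariation 0 A H r) (hr : r ∈ Set.Ico 0 1) (x : Subshift T) :
    |centered A x| ≤ H := by
  obtain ⟨⟨μ, hμ, hmax⟩, -⟩ := isGreatest_maxMean hT (hA.continuous hr)
  have := hμ.1
  calc |centered A x| = ‖∫ y, (A x - A y) ∂μ‖ := by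
        rw [integral_sub (integrable_const _) (hA.integrable hr), hmax]
        simp [centered]
    _ ≤ H * μ.real Set.univ := norm_integral_le_of_norm_le_const <| ae_of_all _ fun y => by
        simpa using hA le_rfl (Agree.zero x y)
    _ = H := by simp

theorem birkhoffSum_centered_nonpos [Nonempty (Subshift T)] (hT : IsTopTransitive T)
    (hA : Continuous A) {n : ℕ} {p : Subshift T} (hn : 0 < n) (hp : shift.IsPeriodicPt n p) :
    birkhoffSum shift (centered A) n p ≤ 0 := by
  obtain ⟨ν, hν, hshift, hint⟩ :=
    exists_measurePreserving_of_isPeriodicPt continuous_shift.measurable hn hp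
  have hle : ∫ x, A x ∂ν ≤ maxMean A := (isGreatest_maxMean hT hA).2 ⟨ν, ⟨hν, hshift⟩, rfl⟩
  have hnonpos : (n : ℝ)⁻¹ * birkhoffSum shift (centered A) n p ≤ 0 := by
    rw [← hint, integral_centered
      (hA.integrable_of_hasCompactSupport (HasCompactSupport.of_compactSpace A))]
    exact sub_nonpos.2 hle
  exact nonpos_of_mul_nonpos_right hnonpos (by positivity)

theorem birkhoffSum_centered_le (hT : IsTopTransitive T) (hg : ConnectsWithin T g)
    (hA : HasExpVariation 0 A H r) (hr : r ∈ Set.Ico 0 1) (n : ℕ) (z : Subshift T) :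
    birkhoffSum shift (centered A) n z ≤ 2 * (H / (1 - r)) + g * H :=
  have : Nonempty (Subshift T) := ⟨z⟩
  birkhoffSum_le_of_isPeriodicPt hg hA.centered hr (abs_centered_le hT hA hr)
    (fun _ _ => birkhoffSum_centered_nonpos hT (hA.continuous hr)) n z

theorem integral_addCoboundary_centered {N₀ : ℕ} (hA : HasExpVariation 0 A H r)
    (hr : r ∈ Set.Ico 0 1) (hW : HasExpVariation N₀ W Q r) (hν : IsInvProb ν) :
    ∫ x, addCoboundary shift (centered A) W x ∂ν = ∫ x, A x ∂ν - maxMean A := by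
  have := hν.1
  rw [integral_addCoboundary hν.2 (hA.centered.integrable hr) (hW.integrable hr),
    integral_centered (hA.integrable hr)]

theorem IsMaximizing.support_subset_aubrySet (hμ : IsMaximizing A μ)
    (hA : HasExpVariation 0 A H r) (hr : r ∈ Set.Ico 0 1)
    (hQ : ∀ n z, birkhoffSum shift (centered A) n z ≤ Q) : μ.support ⊆ aubrySet (centered A) := by
  have := hμ.1.1
  refine SFTMax.support_subset_aubrySet hA.centered hr hQ hμ.1.2 ?_
  rw [integral_centered (hA.integrable hr), hμ.2, sub_self]

theorem nonempty_aubrySet_centered [Nonempty (Subshift T)] (hT : IsTopTransitive T)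
    (hA : HasExpVariation 0 A H r) (hr : r ∈ Set.Ico 0 1)
    (hQ : ∀ n z, birkhoffSum shift (centered A) n z ≤ Q) : (aubrySet (centered A)).Nonempty := by
  obtain ⟨μ, hμ⟩ := (isGreatest_maxMean hT (hA.continuous hr)).1
  have := hμ.1.1
  exact (Measure.nonempty_support (IsProbabilityMeasure.ne_zero μ)).mono
    (IsMaximizing.support_subset_aubrySet hμ hA hr hQ)

theorem isMaximizing_of_support_subset_aubrySet (hA : HasExpVariation 0 A H r)
    (hr : r ∈ Set.Ico 0 1) (hx : x ∈ aubrySet (centered A)) (hW : IsActionFrom (centered A) x W)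
    (hμ : IsInvProb μ) (hsupp : μ.support ⊆ aubrySet (centered A)) : IsMaximizing A μ := by
  refine ⟨hμ, sub_eq_zero.1 ?_⟩
  rw [← integral_addCoboundary_centered hA hr (hW.hasExpVariation_one hA.centered hr hx) hμ]
  refine integral_eq_zero_of_ae ?_
  filter_upwards [Measure.support_mem_ae] with y hy
  exact hW.addCoboundary_eq_zero hA.centered hr (hsupp hy)

theorem isMaximizing_iff_support_subset_aubrySet [Nonempty (Subshift T)] (hT : IsTopTransitive T)
    (hA : HasExpVariation 0 A H r) (hr : r ∈ Set.Ico 0 1) (hμ : IsInvProb μ) :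
    IsMaximizing A μ ↔ μ.support ⊆ aubrySet (centered A) := by
  obtain ⟨g, hg⟩ := hT.exists_connectsWithin
  have hQ := birkhoffSum_centered_le hT hg hA hr
  obtain ⟨x, hx⟩ := nonempty_aubrySet_centered hT hA hr hQ
  obtain ⟨W, hW⟩ := exists_isActionFrom hQ
    (hg.actionGE hA.centered hr (abs_centered_le hT hA hr) hx)
  exact ⟨fun h => h.support_subset_aubrySet hA hr hQ,
    isMaximizing_of_support_subset_aubrySet hA hr hx hW hμ⟩

theorem uniquelyErgodicOn_of_existsUnique {K : Set (Subshift T)} (hK : IsClosed K)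
    (hmax : ∀ ν : Measure (Subshift T), IsInvProb ν → (IsMaximizing A ν ↔ ν.support ⊆ K))
    (h : ∃! μ : Measure (Subshift T), IsMaximizing A μ) : UniquelyErgodicOn K :=
  (existsUnique_congr fun ν => by
    rw [measure_compl_eq_zero_iff_support_subset hK]
    exact ⟨fun hν => ⟨hν.1, (hmax ν hν.1).1 hν⟩, fun hν => (hmax ν hν.1).2 hν.2⟩).1 h

theorem IsMaximizing.uniquelyErgodicOn_support (hμ : IsMaximizing A μ)
    (hext : ∀ ν : Measure (Subshift T), IsInvProb ν → ν.support ⊆ μ.support → IsMaximizing A ν)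
    (h : ∃! μ : Measure (Subshift T), IsMaximizing A μ) : UniquelyErgodicOn μ.support :=
  uniquelyErgodicOn_of_existsUnique Measure.isClosed_support
    (fun ν hν => ⟨fun hν' => h.unique hν' hμ ▸ Set.Subset.rfl, hext ν hν⟩) h

end MaximizingMeasures

section ActionPotential

variable {A W : Subshift T → ℝ} {lam α H Q r c : ℝ} {g : ℕ} {x y : Subshift T}

theorem coe_le_action_iff (hlam : 1 < lam) :
    (c : EReal) ≤ action lam A x y ↔ ActionGE (centered A) 0 x y c := by
  constructor
  · intro h c' hc' M
    have hδ : 0 < (lam ^ M)⁻¹ := by positivity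
    have hlt : (c' : EReal) < actionAt lam A (lam ^ M)⁻¹ x y :=
      (EReal.coe_lt_coe_iff.2 hc').trans_le (h.trans (iInf₂_le _ hδ))
    simp only [actionAt, lt_iSup_iff] at hlt
    obtain ⟨n, z, ⟨hn, hzy, hzx⟩, hc'⟩ := hlt
    exact ⟨n, hn, z, hzy, (symDist_le_iff hlam).1 hzx.le, (EReal.coe_lt_coe_iff.1 hc').le⟩
  · refine fun h => le_iInf₂ fun δ hδ => EReal.ge_of_forall_gt_iff_ge.1 fun c' hc' => ?_
    obtain ⟨M, hM⟩ := exists_pow_lt_of_lt_one hδ (inv_lt_one_of_one_lt₀ hlam)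
    rw [inv_pow] at hM
    obtain ⟨n, hn, z, hzy, hzx, hle⟩ := h (EReal.coe_lt_coe_iff.1 hc') M
    refine le_iSup₂_of_le n z (le_iSup_of_le ⟨hn, hzy, ?_⟩ (EReal.coe_le_coe_iff.2 hle))
    exact ((symDist_le_iff hlam).2 hzx).trans_lt hM

theorem actionAt_le (hQ : ∀ n z, birkhoffSum shift (centered A) n z ≤ Q) (δ : ℝ)
    (x y : Subshift T) : actionAt lam A δ x y ≤ Q :=
  iSup₂_le fun n z => iSup_le fun _ => EReal.coe_le_coe_iff.2 (hQ n z)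

theorem exists_pos_actionAt_lt [hne : Nonempty (Subshift T)]
    (hQ : ∀ n z, birkhoffSum shift (centered A) n z ≤ Q) :
    ∃ Q' : ℝ, 0 < Q' ∧ ∀ (x y : Subshift T) (δ : ℝ), actionAt lam A δ x y < Q' := by
  have hQ0 : 0 ≤ Q := by simpa using hQ 0 hne.some
  exact ⟨Q + 1, by linarith, fun x y δ =>
    (actionAt_le hQ δ x y).trans_lt (EReal.coe_lt_coe_iff.2 (lt_add_one Q))⟩

theorem action_self_nonpos (hlam : 1 < lam) (hφ : HasExpVariation 0 (centered A) H r)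
    (hr : r ∈ Set.Ico 0 1) (hQ : ∀ n z, birkhoffSum shift (centered A) n z ≤ Q) (x : Subshift T) :
    action lam A x x ≤ 0 :=
  EReal.ge_of_forall_gt_iff_ge.1 fun _ hc => EReal.coe_nonpos.2 <|
    ((coe_le_action_iff hlam).1 hc.le).self_nonpos hφ hr hQ

theorem action_triangle (hlam : 1 < lam) (hφ : HasExpVariation 0 (centered A) H r)
    (hr : r ∈ Set.Ico 0 1) (x y z : Subshift T) :
    action lam A x y + action lam A y z ≤ action lam A x z := by
  refine EReal.add_le_of_forall_lt fun a ha b hb => ?_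
  obtain ⟨a', haa', ha'⟩ := EReal.lt_iff_exists_real_btwn.1 ha
  obtain ⟨b', hbb', hb'⟩ := EReal.lt_iff_exists_real_btwn.1 hb
  refine (add_le_add haa'.le hbb'.le).trans ?_
  rw [← EReal.coe_add, coe_le_action_iff hlam]
  exact (((coe_le_action_iff hlam).1 ha'.le).trans hφ hr
    ((coe_le_action_iff hlam).1 hb'.le)).mono (by omega) le_rfl

theorem zeroSet_eq_aubrySet (hlam : 1 < lam) (hφ : HasExpVariation 0 (centered A) H r)
    (hr : r ∈ Set.Ico 0 1) (hQ : ∀ n z, birkhoffSum shift (centered A) n z ≤ Q) :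
    zeroSet lam A = aubrySet (centered A) := by
  ext x
  rw [aubrySet, Set.mem_ofPred_eq, ← coe_le_action_iff hlam, EReal.coe_zero]
  exact eq_comm.trans (action_self_nonpos hlam hφ hr hQ x).ge_iff_eq'.symm

theorem IsActionFrom.action_eq (hW : IsActionFrom (centered A) x W) (hlam : 1 < lam)
    (y : Subshift T) : action lam A x y = W y := by
  refine le_antisymm ?_ ((coe_le_action_iff hlam).2 (hW.2 le_rfl))
  exact EReal.ge_of_forall_gt_iff_ge.1 fun _ hc =>
    EReal.coe_le_coe_iff.2 (hW.1 ((coe_le_action_iff hlam).1 hc.le))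

theorem IsActionFrom.action_le_sub (hW : IsActionFrom (centered A) x W) (hlam : 1 < lam)
    (hφ : HasExpVariation 0 (centered A) H r) (hr : r ∈ Set.Ico 0 1) (y z : Subshift T) :
    action lam A y z ≤ ((W z - W y : ℝ) : EReal) :=
  EReal.ge_of_forall_gt_iff_ge.1 fun _ hc => EReal.coe_le_coe_iff.2 <|
    le_sub_iff_add_le'.2 (hW.add_le hφ hr ((coe_le_action_iff hlam).1 hc.le))

theorem IsActionFrom.holdUpTo_le (hW : IsActionFrom (centered A) x W) (hlam : 1 < lam) (hα : 0 < α)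
    (hA : IsHolder lam α A) (hx : x ∈ aubrySet (centered A)) :
    holdUpTo lam α lam⁻¹ W ≤ (1 / (1 - (lam ^ α)⁻¹)).toNNReal * hold lam α A := by
  have hr := inv_rpow_mem_Ioo hlam hα
  have hW₁ := hW.hasExpVariation_one (hA.hasExpVariation hlam hα).centered
    (Set.Ioo_subset_Ico_self hr) hx
  rw [div_eq_mul_one_div, mul_comm] at hW₁
  simpa only [pow_one] using
    hW₁.holdUpTo_le_mul_hold hlam hα hA (one_div_nonneg.2 (sub_nonneg.2 hr.2.le))

theorem IsActionFrom.hold_le (hW : IsActionFrom (centered A) x W) (hlam : 1 < lam) (hα : 0 < α)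
    (hT : IsTopTransitive T) (hg : ConnectsWithin T g) (hA : IsHolder lam α A)
    (hx : x ∈ aubrySet (centered A)) :
    hold lam α W ≤ (3 / (1 - (lam ^ α)⁻¹) + 2 * g).toNNReal * hold lam α A := by
  have : Nonempty (Subshift T) := ⟨x⟩
  have hr := inv_rpow_mem_Ioo hlam hα
  have hr' := Set.Ioo_subset_Ico_self hr
  have hA' := hA.hasExpVariation hlam hα
  have hr1 : 0 < 1 - (lam ^ α)⁻¹ := sub_pos.2 hr.2
  have hW₀ : HasExpVariation 0 W ((3 / (1 - (lam ^ α)⁻¹) + 2 * g) * (hold lam α A).toReal)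
      (lam ^ α)⁻¹ := by
    convert hW.hasExpVariation_zero hg hA'.centered hr' (abs_centered_le hT hA' hr')
      (birkhoffSum_centered_le hT hg hA' hr') hx using 1
    ring
  simpa only [hold, pow_zero, inv_one] using
    hW₀.holdUpTo_le_mul_hold hlam hα hA (by positivity)

end ActionPotential

end SFTMax

theorem mainTheorem7_general (lam α : ℝ) (hlam : 1 < lam) (hα0 : 0 < α) :
    ∃ C₀ : ℝ≥0, ∀ (k : ℕ) (T : Fin k → Fin k → Prop),
      Nonempty (Subshift T) → IsTopTransitive T →
      ∃ C : ℝ≥0, ∀ A : Subshift T → ℝ, IsHolder lam α A →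
        (∃ Q : ℝ, 0 < Q ∧ ∀ (x y : Subshift T) (δ : ℝ), 0 < δ →
          actionAt lam A δ x y < (Q : EReal)) ∧
        (∀ x : Subshift T, action lam A x x ≤ 0) ∧
        (∀ x y z : Subshift T, action lam A x y + action lam A y z ≤ action lam A x z) ∧
        IsClosed (zeroSet lam A) ∧
        Set.MapsTo shift (zeroSet lam A) (zeroSet lam A) ∧
        (∀ μ : Measure (Subshift T), IsInvProb μ →
          (IsMaximizing A μ ↔ μ.support ⊆ zeroSet lam A)) ∧
        (zeroSet lam A).Nonempty ∧
        (∀ x ∈ zeroSet lam A, ∃ W : Subshift T → ℝ,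
          (∀ y, action lam A x y = (W y : EReal)) ∧
          IsHolder lam α W ∧
          hold lam α W ≤ C * hold lam α A ∧
          holdUpTo lam α lam⁻¹ W ≤ C₀ * hold lam α A ∧
          (∀ y z, action lam A y z ≤ ((W z - W y : ℝ) : EReal)) ∧
          ∃ B : Subshift T → ℝ,
            (∀ y, B y = A y - maxMean A + W y - W (shift y)) ∧
            IsHolder lam α B ∧
            (∀ y, B y ≤ 0) ∧
            (∀ ν : Measure (Subshift T), IsInvProb ν →
              ∫ y, B y ∂ν = ∫ y, A y ∂ν - maxMean A) ∧
            (∀ μ : Measure (Subshift T), IsMaximizing A μ → ∫ y, B y ∂μ = 0) ∧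
            (∀ y ∈ zeroSet lam A, B y = 0) ∧
            (∀ μ : Measure (Subshift T), IsMaximizing A μ → ∀ y ∈ μ.support, B y = 0)) ∧
        (∀ μ : Measure (Subshift T), IsMaximizing A μ →
          ∀ ν : Measure (Subshift T), IsInvProb ν → ν.support ⊆ μ.support → IsMaximizing A ν) ∧
        ((∃! μ : Measure (Subshift T), IsMaximizing A μ) →
          UniquelyErgodicOn (zeroSet lam A) ∧
          ∀ μ : Measure (Subshift T), IsMaximizing A μ → UniquelyErgodicOn μ.support) := by
  have hr := inv_rpow_mem_Ioo hlam hα0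
  have hr' := Set.Ioo_subset_Ico_self hr
  refine ⟨(1 / (1 - (lam ^ α)⁻¹)).toNNReal, fun k T hne hT => ?_⟩
  obtain ⟨g, hg⟩ := hT.exists_connectsWithin
  refine ⟨(3 / (1 - (lam ^ α)⁻¹) + 2 * g).toNNReal, fun A hHold => ?_⟩
  have hA := hHold.hasExpVariation hlam hα0
  have hφ := hA.centered
  have hb := abs_centered_le hT hA hr'
  have hQ := birkhoffSum_centered_le hT hg hA hr'
  have hclosed := isClosed_aubrySet hφ hr'
  have hmax := fun μ => isMaximizing_iff_support_subset_aubrySet (μ := μ) hT hA hr'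
  have hext : ∀ μ, IsMaximizing A μ → ∀ ν, IsInvProb ν → ν.support ⊆ μ.support →
      IsMaximizing A ν := fun μ hμ ν hν h => (hmax ν hν).2 (h.trans ((hmax μ hμ.1).1 hμ))
  rw [zeroSet_eq_aubrySet hlam hφ hr' hQ]
  obtain ⟨Q, hQ0, hQlt⟩ := exists_pos_actionAt_lt (lam := lam) hQ
  refine ⟨⟨Q, hQ0, fun x y δ _ => hQlt x y δ⟩, action_self_nonpos hlam hφ hr' hQ,
    action_triangle hlam hφ hr', hclosed, mapsTo_shift_aubrySet hφ hr', hmax,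
    nonempty_aubrySet_centered hT hA hr' hQ, fun x hx => ?_, hext, fun huniq =>
    ⟨uniquelyErgodicOn_of_existsUnique hclosed hmax huniq, fun μ hμ =>
      hμ.uniquelyErgodicOn_support (hext μ hμ) huniq⟩⟩
  obtain ⟨W, hW⟩ := exists_isActionFrom hQ (hg.actionGE hφ hr' hb hx)
  have hW₀ := hW.hasExpVariation_zero hg hφ hr' hb hQ hx
  have hzero := fun y => hW.addCoboundary_eq_zero (y := y) hφ hr'
  have hint := fun ν => integral_addCoboundary_centered (ν := ν) hA hr' hW₀
  exact ⟨W, hW.action_eq hlam, hW₀.isHolder hlam hα0, hW.hold_le hlam hα0 hT hg hHold hx,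
    hW.holdUpTo_le hlam hα0 hHold hx, hW.action_le_sub hlam hφ hr', addCoboundary shift _ W,
    fun _ => rfl, (hφ.addCoboundary hW₀ hr).isHolder hlam hα0, hW.addCoboundary_nonpos hφ hr',
    hint, fun μ hμ => (hint μ hμ.1).trans (sub_eq_zero.2 hμ.2), hzero,
    fun μ hμ y hy => hzero y ((hmax μ hμ.1).1 hμ hy)⟩

theorem mainTheorem7 (lam α : ℝ) (hlam : 1 < lam) (hα0 : 0 < α) (hα1 : α ≤ 1) :
    -- `C₀` depends on `lam` and `α` only, `C` on `lam`, `α` and the subshift.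
    ∃ C₀ : ℝ≥0, ∀ (k : ℕ) (T : Fin k → Fin k → Prop),
      Nonempty (Subshift T) → IsTopMixing T →
      ∃ C : ℝ≥0, ∀ A : Subshift T → ℝ, IsHolder lam α A →
        -- The action potential is bounded above.
        (∃ Q : ℝ, 0 < Q ∧ ∀ (x y : Subshift T) (δ : ℝ), 0 < δ → actionAt lam A δ x y < (Q : EReal)) ∧
        (∀ x : Subshift T, action lam A x x ≤ 0) ∧
        -- Triangle inequality.
        (∀ x y z : Subshift T, action lam A x y + action lam A y z ≤ action lam A x z) ∧
        -- The set `𝔖` and the maximizing measures.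
        IsClosed (zeroSet lam A) ∧
        Set.MapsTo shift (zeroSet lam A) (zeroSet lam A) ∧
        (∀ μ : Measure (Subshift T), IsInvProb μ →
          (IsMaximizing A μ ↔ μ.support ⊆ zeroSet lam A)) ∧
        (zeroSet lam A).Nonempty ∧
        -- For `x ∈ 𝔖` the function `W = S(x, ·)` and the function `B = A - m(A) + W - W ∘ σ`.
        (∀ x ∈ zeroSet lam A, ∃ W : Subshift T → ℝ,
          (∀ y, action lam A x y = (W y : EReal)) ∧
          IsHolder lam α W ∧
          hold lam α W ≤ C * hold lam α A ∧
          holdUpTo lam α lam⁻¹ W ≤ C₀ * hold lam α A ∧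
          (∀ y z, action lam A y z ≤ ((W z - W y : ℝ) : EReal)) ∧
          ∃ B : Subshift T → ℝ,
            (∀ y, B y = A y - maxMean A + W y - W (shift y)) ∧
            IsHolder lam α B ∧
            (∀ y, B y ≤ 0) ∧
            (∀ ν : Measure (Subshift T), IsInvProb ν →
              ∫ y, B y ∂ν = ∫ y, A y ∂ν - maxMean A) ∧
            (∀ μ : Measure (Subshift T), IsMaximizing A μ → ∫ y, B y ∂μ = 0) ∧
            (∀ y ∈ zeroSet lam A, B y = 0) ∧
            (∀ μ : Measure (Subshift T), IsMaximizing A μ → ∀ y ∈ μ.support, B y = 0)) ∧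
        -- Measures carried by the support of a maximizing measure; unique ergodicity.
        (∀ μ : Measure (Subshift T), IsMaximizing A μ →
          ∀ ν : Measure (Subshift T), IsInvProb ν → ν.support ⊆ μ.support → IsMaximizing A ν) ∧
        ((∃! μ : Measure (Subshift T), IsMaximizing A μ) →
          UniquelyErgodicOn (zeroSet lam A) ∧
          ∀ μ : Measure (Subshift T), IsMaximizing A μ → UniquelyErgodicOn μ.support) := by
  obtain ⟨C₀, hC₀⟩ := mainTheorem7_general lam α hlam hα0
  exact ⟨C₀, fun k T hne hT => hC₀ k T hne hT.isTopTransitive⟩
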